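/- Let $(\mathcal C,\otimes,\mathbb 1)$ be a monoidal category and $\mathcal D$ a category. A *tensorisation* of $\mathcal D$ by $\mathcal C$ is a bifunctor $\boxtimes:\mathcal C\times\mathcal D\to\mathcal D$ with natural maps $\mathbb 1\boxtimes X\to X$ and $(V\otimes W)\boxtimes X\to V\boxtimes(W\boxtimes X)$, not necessarily invertible, satisfying the pentagon and the two unit conditions (a lax left $\mathcal C$-module). A *cotensorisation* is a bifunctor $\langle-,-\rangle:\mathcal D\times\mathcal C^{\mathrm{op}}\to\mathcal D$ with natural maps $X\to\langle X,\mathbb 1\rangle$ and $\langle\langle X,V\rangle,W\rangle\to\langle X,V\otimes W\rangle$ satisfying the analogous conditions (a lax right $\mathcal C$-module structure on $\mathcal D^{\mathrm{op}}$). A *TCE* (tensored, cotensored, enriched) structure on $\mathcal D$ over $\mathcal C$ consists of bifunctors $\boxtimes$, $\langle-,-\rangle$ as above and $\{-,-\}:\mathcal D^{\mathrm{op}}\times\mathcal D\to\mathcal C$, natural bijections $$\mathrm{Hom}_{\mathcal C}(V,\{X,Y\})\simeq\mathrm{Hom}_{\mathcal D}(V\boxtimes X,Y)\simeq\mathrm{Hom}_{\mathcal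 D}(X,\langle Y,V\rangle),$$ and a tensorisation structure on $\boxtimes$, a cotensorisation structure on $\langle-,-\rangle$ and an enrichment on $\{-,-\}$ (units $\mathbb 1\to\{X,X\}$ and an associative, unital composition $\{Y,Z\}\otimes\{X,Y\}\to\{X,Z\}$) which correspond to each other under these bijections (so each of the three structures determines the other two). Let $\mathcal D$ have a TCE structure over $\mathcal C$. Suppose that $\mathcal C$ has all coreflexive equalisers, and let $Q$ be a Hopf comonad on $\mathcal C$ (a comonad whose underlying functor is lax monoidal and whose counit and comultiplication are monoidal natural transformations) which preserves coreflexive equalisers. The category $\mathrm{Cog}(Q)$ of $Q$-coalgebras is then monoidal, with the tensor product and unit of $\mathcal C$. (1) Suppose that $\mathcal D$ has all coreflexive equalisers, and let $R$ be a comonad on $\mathcal D$ which preserves them. Every tensorisation $\mathrm{Cog}(Q)\times\mathrm{Cog}(R)\to\mathrm{Cog}(R)$ of $R$-coalgebras by $Q$-coalgebras which lifts the tensorisation of $\mathcal D$ by $\mathcal C$ (that is, the forgetful functors strictly commute with the bifunctors and send the structure maps to the structure maps) is the tensorisation of a TCE structure on $\mathrm{Cog}(R)$ over $\mathrm{Cog}(Q)$.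 (2) Suppose that $\mathcal D$ has all reflexive coequalisers, and let $M$ be a monad on $\mathcal D$ which preserves them. Every cotensorisation $\mathrm{Alg}(M)\times\mathrm{Cog}(Q)^{\mathrm{op}}\to\mathrm{Alg}(M)$ of $M$-algebras by $Q$-coalgebras which lifts, in the same sense, the cotensorisation of $\mathcal D$ by $\mathcal C$ is the cotensorisation of a TCE structure on $\mathrm{Alg}(M)$ over $\mathrm{Cog}(Q)$. -/

import Mathlib

open CategoryTheory CategoryTheory.Limits MonoidalCategory Opposite

universe v₁ v₂ u₁ u₂

/-! ### Hopf comonads and the monoidal category of coalgebras -/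

section HopfComonad

variable {C : Type u₁} [Category.{v₁} C] [MonoidalCategory C]

/-- A Hopf comonad on a monoidal category: a comonad `Q` whose underlying endofunctor is lax
monoidal, in such a way that the counit `Q ⟶ 𝟭` and the comultiplication `Q ⟶ QQ` are monoidal
natural transformations. -/
class HopfComonad (Q : Comonad C) extends Q.toFunctor.LaxMonoidal where
  counit_isMonoidal : NatTrans.IsMonoidal Q.ε
  comul_isMonoidal : NatTrans.IsMonoidal Q.δ

attribute [instance] HopfComonad.counit_isMonoidal HopfComonad.comul_isMonoidal

namespace HopfComonad

open Functor.LaxMonoidal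

variable (Q : Comonad C) [HopfComonad Q]

lemma unit_counit : ε Q.toFunctor ≫ Q.ε.app (𝟙_ C) = 𝟙 (𝟙_ C) := by
  simp

lemma unit_comul :
    ε Q.toFunctor ≫ Q.δ.app (𝟙_ C) = ε Q.toFunctor ≫ Q.map (ε Q.toFunctor) := by
  simp

lemma tensor_counit (X Y : C) :
    μ Q.toFunctor X Y ≫ Q.ε.app (X ⊗ Y) = Q.ε.app X ⊗ₘ Q.ε.app Y := by
  simp

lemma tensor_comul (X Y : C) :
    μ Q.toFunctor X Y ≫ Q.δ.app (X ⊗ Y) =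
      (Q.δ.app X ⊗ₘ Q.δ.app Y) ≫ μ Q.toFunctor (Q.obj X) (Q.obj Y) ≫
        Q.map (μ Q.toFunctor X Y) := by
  simp


/-- The unit coalgebra `𝟙_ C ⟶ Q (𝟙_ C)`. -/
abbrev unitCoalgebra : Q.Coalgebra where
  A := 𝟙_ C
  a := ε Q.toFunctor
  counit := unit_counit Q
  coassoc := unit_comul Q

variable {Q}

/-- The tensor product of two coalgebras, with structure map
`V ⊗ W ⟶ Q V ⊗ Q W ⟶ Q (V ⊗ W)`. -/
abbrev tensorCoalgebra (V W : Q.Coalgebra) : Q.Coalgebra where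
  A := V.A ⊗ W.A
  a := (V.a ⊗ₘ W.a) ≫ μ Q.toFunctor V.A W.A
  counit := by
    rw [Category.assoc, tensor_counit, tensorHom_comp_tensorHom, V.counit, W.counit,
      id_tensorHom_id]
  coassoc := by
    rw [Category.assoc, tensor_comul, tensorHom_comp_tensorHom_assoc, V.coassoc, W.coassoc,
      ← tensorHom_comp_tensorHom_assoc, Functor.map_comp, Category.assoc, μ_natural_assoc]

/-- The tensor product of two coalgebra morphisms. -/
abbrev tensorCoalgebraHom {V V' W W' : Q.Coalgebra} (f : V ⟶ V') (g : W ⟶ W') :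
    tensorCoalgebra V W ⟶ tensorCoalgebra V' W' where
  f := f.f ⊗ₘ g.f
  h := by
    rw [Category.assoc, ← μ_natural, tensorHom_comp_tensorHom_assoc, f.h, g.h,
      ← tensorHom_comp_tensorHom_assoc]

lemma associator_comm (U V W : Q.Coalgebra) :
    (tensorCoalgebra (tensorCoalgebra U V) W).a ≫ Q.map (α_ U.A V.A W.A).hom =
      (α_ U.A V.A W.A).hom ≫ (tensorCoalgebra U (tensorCoalgebra V W)).a := by
  dsimp only
  rw [← tensorHom_comp_whiskerRight, ← tensorHom_comp_whiskerLeft, Category.assoc,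
    Category.assoc, Category.assoc, ← associator_naturality_assoc,
    Functor.LaxMonoidal.associativity]

lemma leftUnitor_comm (V : Q.Coalgebra) :
    (tensorCoalgebra (unitCoalgebra Q) V).a ≫ Q.map (λ_ V.A).hom = (λ_ V.A).hom ≫ V.a := by
  rw [← leftUnitor_naturality, Functor.LaxMonoidal.left_unitality,
    ← Category.assoc, ← Category.assoc, ← MonoidalCategory.tensorHom_def']

lemma rightUnitor_comm (V : Q.Coalgebra) :
    (tensorCoalgebra V (unitCoalgebra Q)).a ≫ Q.map (ρ_ V.A).hom = (ρ_ V.A).hom ≫ V.a := by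
  rw [← rightUnitor_naturality, Functor.LaxMonoidal.right_unitality,
    ← Category.assoc, ← Category.assoc, ← MonoidalCategory.tensorHom_def]

/-- The monoidal structure on coalgebras over a Hopf comonad; the forgetful functor to `C` is
strictly monoidal. -/
instance : MonoidalCategory Q.Coalgebra where
  tensorObj := tensorCoalgebra
  tensorUnit := unitCoalgebra Q
  tensorHom f g := tensorCoalgebraHom f g
  whiskerLeft V _ _ g :=
    { f := V.A ◁ g.f, h := by simpa using (tensorCoalgebraHom (𝟙 V) g).h }
  whiskerRight f V :=
    { f := f.f ▷ V.A, h := by simpa using (tensorCoalgebraHom f (𝟙 V)).h }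
  associator U V W := Comonad.Coalgebra.isoMk (α_ U.A V.A W.A) (associator_comm U V W)
  leftUnitor V := Comonad.Coalgebra.isoMk (λ_ V.A) (leftUnitor_comm V)
  rightUnitor V := Comonad.Coalgebra.isoMk (ρ_ V.A) (rightUnitor_comm V)
  tensorHom_def f g := by ext; simp [MonoidalCategory.tensorHom_def]
  id_tensorHom_id _ _ := by ext; simp
  tensorHom_comp_tensorHom _ _ _ _ := by ext; simp
  whiskerLeft_id _ _ := by ext; simp
  id_whiskerRight _ _ := by ext; simp
  associator_naturality _ _ _ := by ext; simp
  leftUnitor_naturality _ := by ext; simp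
  rightUnitor_naturality _ := by ext; simp
  pentagon _ _ _ _ := by ext; simp
  triangle _ _ := by ext; simp

end HopfComonad

end HopfComonad

/-! ### Categories tensored, cotensored and enriched over a monoidal category -/

section TCE

/-- The action of a bifunctor on a pair of morphisms. -/
abbrev bifunctorMap {A B K : Type*} [Category* A] [Category* B] [Category* K] (F : A ⥤ B ⥤ K)
    {a a' : A} {b b' : B} (f : a ⟶ a') (g : b ⟶ b') : (F.obj a).obj b ⟶ (F.obj a').obj b' :=
  (F.map f).app b ≫ (F.obj a').map g

variable (E : Type u₁) [Category.{v₁} E] [MonoidalCategory E]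
  (D : Type u₂) [Category.{v₂} D]

/-- A tensorisation of `D` by the monoidal category `E`, that is a lax `E`-module structure on `D`:
a bifunctor `V ⊠ X = (act.obj V).obj X` with natural maps `𝟙 ⊠ X ⟶ X` and
`(V ⊗ W) ⊠ X ⟶ V ⊠ (W ⊠ X)`, not required to be invertible, satisfying the pentagon and the two
unit conditions. Equivalently, an oplax monoidal functor from `E` to the endofunctors of `D`. -/
structure Tensorisation where
  act : E ⥤ D ⥤ D
  unit (X : D) : (act.obj (𝟙_ E)).obj X ⟶ X
  assoc (V W : E) (X : D) :
    (act.obj (V ⊗ W)).obj X ⟶ (act.obj V).obj ((act.obj W).obj X)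
  unit_naturality {X X' : D} (x : X ⟶ X') :
    (act.obj (𝟙_ E)).map x ≫ unit X' = unit X ≫ x
  assoc_naturality {V V' W W' : E} {X X' : D} (v : V ⟶ V') (w : W ⟶ W') (x : X ⟶ X') :
    bifunctorMap act (v ⊗ₘ w) x ≫ assoc V' W' X' =
      assoc V W X ≫ bifunctorMap act v (bifunctorMap act w x)
  pentagon (U V W : E) (X : D) :
    assoc (U ⊗ V) W X ≫ assoc U V ((act.obj W).obj X) =
      (act.map (α_ U V W).hom).app X ≫ assoc U (V ⊗ W) X ≫ (act.obj U).map (assoc V W X)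
  left_unitality (V : E) (X : D) :
    assoc (𝟙_ E) V X ≫ unit ((act.obj V).obj X) = (act.map (λ_ V).hom).app X
  right_unitality (V : E) (X : D) :
    assoc V (𝟙_ E) X ≫ (act.obj V).map (unit X) = (act.map (ρ_ V).hom).app X

/-- A cotensorisation of `D` by the monoidal category `E`: a bifunctor
`⟨X, V⟩ = (cot.obj X).obj (op V)` with natural maps `X ⟶ ⟨X, 𝟙⟩` and
`⟨⟨X, V⟩, W⟩ ⟶ ⟨X, V ⊗ W⟩`, not required to be invertible, satisfying the pentagon and the two unit
conditions. Equivalently, a lax right `E`-module structure on `Dᵒᵖ`. -/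
structure Cotensorisation where
  cot : D ⥤ Eᵒᵖ ⥤ D
  unit (X : D) : X ⟶ (cot.obj X).obj (op (𝟙_ E))
  assoc (X : D) (V W : E) :
    (cot.obj ((cot.obj X).obj (op V))).obj (op W) ⟶ (cot.obj X).obj (op (V ⊗ W))
  unit_naturality {X X' : D} (x : X ⟶ X') :
    x ≫ unit X' = unit X ≫ (cot.map x).app (op (𝟙_ E))
  assoc_naturality {X X' : D} {V V' W W' : E} (x : X ⟶ X') (v : V' ⟶ V) (w : W' ⟶ W) :
    bifunctorMap cot (bifunctorMap cot x v.op) w.op ≫ assoc X' V' W' =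
      assoc X V W ≫ bifunctorMap cot x (v ⊗ₘ w).op
  pentagon (X : D) (U V W : E) :
    (cot.map (assoc X U V)).app (op W) ≫ assoc X (U ⊗ V) W ≫ (cot.obj X).map (α_ U V W).inv.op =
      assoc ((cot.obj X).obj (op U)) V W ≫ assoc X U (V ⊗ W)
  left_unitality (X : D) (V : E) :
    (cot.map (unit X)).app (op V) ≫ assoc X (𝟙_ E) V = (cot.obj X).map (λ_ V).hom.op
  right_unitality (X : D) (V : E) :
    unit ((cot.obj X).obj (op V)) ≫ assoc X V (𝟙_ E) = (cot.obj X).map (ρ_ V).hom.op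

/-- An enrichment of (the objects of) `D` over the monoidal category `E`, whose mapping objects
`{X, Y} = (hom.obj (op X)).obj Y` are the values of a bifunctor, with an associative and unital
composition `{Y, Z} ⊗ {X, Y} ⟶ {X, Z}`. -/
structure Enrichment where
  hom : Dᵒᵖ ⥤ D ⥤ E
  id (X : D) : 𝟙_ E ⟶ (hom.obj (op X)).obj X
  comp (X Y Z : D) :
    (hom.obj (op Y)).obj Z ⊗ (hom.obj (op X)).obj Y ⟶ (hom.obj (op X)).obj Z
  comp_assoc (X Y Z T : D) :
    comp Y Z T ▷ (hom.obj (op X)).obj Y ≫ comp X Y T =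
      (α_ _ _ _).hom ≫ (hom.obj (op Z)).obj T ◁ comp X Y Z ≫ comp X Z T
  id_comp (X Y : D) :
    (hom.obj (op X)).obj Y ◁ id X ≫ comp X X Y = (ρ_ _).hom
  comp_id (X Y : D) :
    id Y ▷ (hom.obj (op X)).obj Y ≫ comp X Y Y = (λ_ _).hom

/-- A structure of a tensored-cotensored-enriched (TCE) category over `E` on `D`: bifunctors
`V ⊠ X`, `⟨X, V⟩`, `{X, Y}`, natural bijections
`Hom(V ⊠ X, Y) ≃ Hom(V, {X, Y})` and `Hom(V ⊠ X, Y) ≃ Hom(X, ⟨Y, V⟩)`, and structures of a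
tensorisation, a cotensorisation and an enrichment on these bifunctors that correspond to each other
under the bijections. Each of the three structures determines the other two (in particular the
naturality of the composition of the enrichment is automatic). -/
structure TCE where
  tens : Tensorisation E D
  cotens : Cotensorisation E D
  enr : Enrichment E D
  homEquiv (V : E) (X Y : D) :
    ((tens.act.obj V).obj X ⟶ Y) ≃ (V ⟶ (enr.hom.obj (op X)).obj Y)
  cotEquiv (V : E) (X Y : D) :
    ((tens.act.obj V).obj X ⟶ Y) ≃ (X ⟶ (cotens.cot.obj Y).obj (op V))
  homEquiv_naturality {V V' : E} {X X' Y Y' : D} (v : V' ⟶ V) (x : X' ⟶ X) (y : Y ⟶ Y')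
    (f : (tens.act.obj V).obj X ⟶ Y) :
    homEquiv V' X' Y' (bifunctorMap tens.act v x ≫ f ≫ y) =
      v ≫ homEquiv V X Y f ≫ bifunctorMap enr.hom x.op y
  cotEquiv_naturality {V V' : E} {X X' Y Y' : D} (v : V' ⟶ V) (x : X' ⟶ X) (y : Y ⟶ Y')
    (f : (tens.act.obj V).obj X ⟶ Y) :
    cotEquiv V' X' Y' (bifunctorMap tens.act v x ≫ f ≫ y) =
      x ≫ cotEquiv V X Y f ≫ bifunctorMap cotens.cot y v.op
  /-- The unit of the enrichment is adjoint to `𝟙 ⊠ X ⟶ X`. -/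
  homEquiv_unit (X : D) : homEquiv (𝟙_ E) X X (tens.unit X) = enr.id X
  /-- The composition of the enrichment is adjoint to
  `({Y, Z} ⊗ {X, Y}) ⊠ X ⟶ {Y, Z} ⊠ ({X, Y} ⊠ X) ⟶ {Y, Z} ⊠ Y ⟶ Z`. -/
  homEquiv_comp (X Y Z : D) :
    homEquiv _ X Z (tens.assoc ((enr.hom.obj (op Y)).obj Z) ((enr.hom.obj (op X)).obj Y) X ≫
      (tens.act.obj _).map ((homEquiv _ X Y).symm (𝟙 _)) ≫ (homEquiv _ Y Z).symm (𝟙 _)) =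
      enr.comp X Y Z
  /-- The map `X ⟶ ⟨X, 𝟙⟩` is adjoint to `𝟙 ⊠ X ⟶ X`. -/
  cotEquiv_unit (X : D) : cotEquiv (𝟙_ E) X X (tens.unit X) = cotens.unit X
  /-- The maps `(V ⊗ W) ⊠ X ⟶ V ⊠ (W ⊠ X)` and `⟨⟨Y, V⟩, W⟩ ⟶ ⟨Y, V ⊗ W⟩` are mates: they induce
  the same map from `Hom(V ⊠ (W ⊠ X), Y) ≃ Hom(X, ⟨⟨Y, V⟩, W⟩)` to
  `Hom((V ⊗ W) ⊠ X, Y) ≃ Hom(X, ⟨Y, V ⊗ W⟩)`. -/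
  cotEquiv_assoc (V W : E) (X Y : D) (f : (tens.act.obj V).obj ((tens.act.obj W).obj X) ⟶ Y) :
    cotEquiv (V ⊗ W) X Y (tens.assoc V W X ≫ f) =
      cotEquiv W X _ (cotEquiv V _ Y f) ≫ cotens.assoc Y V W

end TCE

/-! ### Lifts of tensorisations and cotensorisations to (co)algebras -/

section Lifts

variable {C : Type u₁} [Category.{v₁} C] [MonoidalCategory C] {Q : Comonad C} [HopfComonad Q]
  {D : Type u₂} [Category.{v₂} D]

/-- A tensorisation of `R`-coalgebras by `Q`-coalgebras lifts a tensorisation of `D` by `C` if the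
forgetful functors (strictly) commute with the two bifunctors, and send the structure maps to the
structure maps. -/
structure Tensorisation.Lifts {R : Comonad D} (T' : Tensorisation Q.Coalgebra R.Coalgebra)
    (T : Tensorisation C D) : Prop where
  act_eq : T'.act ⋙ (Functor.whiskeringRight _ _ _).obj R.forget =
    Q.forget ⋙ T.act ⋙ (Functor.whiskeringLeft _ _ _).obj R.forget
  unit_eq (X : R.Coalgebra) :
    R.forget.map (T'.unit X) = ((eqToHom act_eq).app (𝟙_ Q.Coalgebra)).app X ≫ T.unit X.A
  assoc_eq (V W : Q.Coalgebra) (X : R.Coalgebra) :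
    R.forget.map (T'.assoc V W X) ≫ ((eqToHom act_eq).app V).app ((T'.act.obj W).obj X) ≫
        (T.act.obj V.A).map (((eqToHom act_eq).app W).app X) =
      ((eqToHom act_eq).app (V ⊗ W)).app X ≫ T.assoc V.A W.A X.A

/-- A cotensorisation of `M`-algebras by `Q`-coalgebras lifts a cotensorisation of `D` by `C` if the
forgetful functors (strictly) commute with the two bifunctors, and send the structure maps to the
structure maps. -/
structure Cotensorisation.Lifts {M : Monad D} (T' : Cotensorisation Q.Coalgebra M.Algebra)
    (T : Cotensorisation C D) : Prop where
  cot_eq : T'.cot ⋙ (Functor.whiskeringRight _ _ _).obj M.forget =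
    M.forget ⋙ T.cot ⋙ (Functor.whiskeringLeft _ _ _).obj Q.forget.op
  unit_eq (X : M.Algebra) :
    M.forget.map (T'.unit X) ≫ ((eqToHom cot_eq).app X).app (op (𝟙_ Q.Coalgebra)) = T.unit X.A
  assoc_eq (X : M.Algebra) (V W : Q.Coalgebra) :
    M.forget.map (T'.assoc X V W) ≫ ((eqToHom cot_eq).app X).app (op (V ⊗ W)) =
      ((eqToHom cot_eq).app ((T'.cot.obj X).obj (op V))).app (op W) ≫
        (T.cot.map (((eqToHom cot_eq).app X).app (op V))).app (op W.A) ≫ T.assoc X.A V.A W.A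

end Lifts

/-! ### Adjunctions with a parameter from pointwise adjoints -/

section Parametrized

variable {A B K : Type*} [Category* A] [Category* B] [Category* K]

/-! A tensorisation belongs to a TCE structure as soon as every `V ⊠ -` and every `- ⊠ X` has a
right adjoint. The pointwise adjoints assemble into bifunctors `⟨-,-⟩` and `{-,-}`, the structure
maps are defined by transposition, and each axiom transposes to an axiom of the tensorisation
(`Tensorisation.exists_tce`). Dually, a cotensorisation needs left adjoints of every `⟨-, V⟩` and of
every `⟨Y, -⟩` as a functor on the opposite category (`Cotensorisation.exists_tce`).

For (co)algebras these adjoints come from the adjoint lifting theorem. Forgetful functors are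
(co)monadic, and a lifted action covers an action on `D` whose partial functors have adjoints by the
given TCE structure. It remains to have coreflexive equalisers (resp. reflexive coequalisers) in the
source of each lifted functor; the forgetful functor creates them because the comonad (resp. monad)
preserves them. -/

lemma exists_parametrizedAdjunction_right (F : A ⥤ B ⥤ K) (hF : ∀ a, (F.obj a).IsLeftAdjoint) :
    ∃ G : Aᵒᵖ ⥤ K ⥤ B, Nonempty (F ⊣₂ G) := by
  let adj (a : A) := Adjunction.ofIsLeftAdjoint (F.obj a)
  -- Taking conjugates is functorial and reverses direction, so it carries the dependence of `F` on
  -- the parameter over to the chosen right adjoints.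
  refine ⟨{ obj a := (F.obj a.unop).rightAdjoint
            map f := conjugateEquiv (adj _) (adj _) (F.map f.unop)
            map_id a := by simp
            map_comp f g := by simp [conjugateEquiv_comp] }, ⟨.mk' adj fun f _ _ g ↦ ?_⟩⟩
  apply ((adj _).homEquiv _ _).symm.injective
  simp [Adjunction.homEquiv_unit, Adjunction.homEquiv_counit]

lemma exists_parametrizedAdjunction_left (G : Aᵒᵖ ⥤ K ⥤ B)
    (hG : ∀ a, (G.obj a).IsRightAdjoint) :
    ∃ F : A ⥤ B ⥤ K, Nonempty (F ⊣₂ G) := by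
  let adj (a : A) := Adjunction.ofIsRightAdjoint (G.obj (op a))
  refine ⟨{ obj a := (G.obj (op a)).leftAdjoint
            map f := (conjugateEquiv (adj _) (adj _)).symm (G.map f.op)
            map_id a := by simp
            map_comp f g := by simp [conjugateEquiv_symm_comp] }, ⟨.mk' adj fun f _ _ g ↦ ?_⟩⟩
  simp [Adjunction.homEquiv_unit]

end Parametrized

/-! ### Calculus of the bijection between tensors and cotensors -/

section CotensorEquiv

variable {E D : Type*} [Category* E] [Category* D] {F : E ⥤ D ⥤ D} {G : D ⥤ Eᵒᵖ ⥤ D} (c : F ⊣₂ G.flip)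

/-- The bijection `Hom(V ⊠ X, Y) ≃ Hom(X, ⟨Y, V⟩)` of an adjunction with a parameter in `E`. -/
def cotensorEquiv (V : E) (X Y : D) : ((F.obj V).obj X ⟶ Y) ≃ (X ⟶ (G.obj Y).obj (op V)) :=
  c.homEquiv

lemma cotensorEquiv_map {V V' : E} (v : V' ⟶ V) {X Y : D} (f : (F.obj V).obj X ⟶ Y) :
    cotensorEquiv c V' X Y ((F.map v).app X ≫ f) =
      cotensorEquiv c V X Y f ≫ (G.obj Y).map v.op :=
  c.homEquiv_naturality_one v f

lemma cotensorEquiv_comp_left (V : E) {X X' Y : D} (x : X' ⟶ X) (f : (F.obj V).obj X ⟶ Y) :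
    cotensorEquiv c V X' Y ((F.obj V).map x ≫ f) = x ≫ cotensorEquiv c V X Y f :=
  c.homEquiv_naturality_two x f

lemma cotensorEquiv_comp_right (V : E) {X Y Y' : D} (y : Y ⟶ Y') (f : (F.obj V).obj X ⟶ Y) :
    cotensorEquiv c V X Y' (f ≫ y) = cotensorEquiv c V X Y f ≫ (G.map y).app (op V) :=
  c.homEquiv_naturality_three y f

lemma cotensorEquiv_symm_comp_left (V : E) {X X' Y : D} (x : X' ⟶ X)
    (g : X ⟶ (G.obj Y).obj (op V)) :
    (cotensorEquiv c V X' Y).symm (x ≫ g) = (F.obj V).map x ≫ (cotensorEquiv c V X Y).symm g :=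
  c.homEquiv_symm_naturality_two x g

lemma eq_of_cotensorEquiv_comp {V : E} {X Z : D} {a b : (F.obj V).obj X ⟶ Z}
    (hab : ∀ (Y : D) (f : Z ⟶ Y), cotensorEquiv c V X Y (a ≫ f) = cotensorEquiv c V X Y (b ≫ f)) :
    a = b := by
  simpa using hab _ (𝟙 Z)

/-- By Yoneda: the identity of `⟨Y, V⟩` is itself a transpose. This reduces identities between
cotensor maps to identities between tensor maps. -/
lemma cotensorEquiv_hom_ext {V : E} {Y Z : D} {a b : (G.obj Y).obj (op V) ⟶ Z}
    (hab : ∀ (X : D) (f : (F.obj V).obj X ⟶ Y),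
      cotensorEquiv c V X Y f ≫ a = cotensorEquiv c V X Y f ≫ b) : a = b := by
  simpa using hab _ ((cotensorEquiv c V _ _).symm (𝟙 _))

lemma cotensorEquiv_hom_ext₂ {V W : E} {Y Z : D}
    {a b : (G.obj ((G.obj Y).obj (op V))).obj (op W) ⟶ Z}
    (hab : ∀ (X : D) (f : (F.obj V).obj ((F.obj W).obj X) ⟶ Y),
      cotensorEquiv c W _ _ (cotensorEquiv c V _ _ f) ≫ a =
        cotensorEquiv c W _ _ (cotensorEquiv c V _ _ f) ≫ b) : a = b :=
  cotensorEquiv_hom_ext c fun X f ↦ by simpa using hab X ((cotensorEquiv c V _ _).symm f)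

end CotensorEquiv

/-! ### The enrichment determined by a tensorisation -/

section TCE

variable {E : Type u₁} [Category.{v₁} E] [MonoidalCategory E] {D : Type u₂} [Category.{v₂} D]

namespace Tensorisation

variable (T : Tensorisation E D)

lemma assoc_naturality_left {V V' : E} (v : V ⟶ V') (W : E) (X : D) :
    (T.act.map (v ▷ W)).app X ≫ T.assoc V' W X =
      T.assoc V W X ≫ (T.act.map v).app _ := by
  simpa [bifunctorMap] using T.assoc_naturality v (𝟙 W) (𝟙 X)

lemma assoc_naturality_middle (V : E) {W W' : E} (w : W ⟶ W') (X : D) :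
    (T.act.map (V ◁ w)).app X ≫ T.assoc V W' X =
      T.assoc V W X ≫ (T.act.obj V).map ((T.act.map w).app X) := by
  simpa [bifunctorMap] using T.assoc_naturality (𝟙 V) w (𝟙 X)

lemma assoc_naturality_right (V W : E) {X X' : D} (x : X ⟶ X') :
    (T.act.obj (V ⊗ W)).map x ≫ T.assoc V W X' =
      T.assoc V W X ≫ (T.act.obj V).map ((T.act.obj W).map x) := by
  simpa [bifunctorMap] using T.assoc_naturality (𝟙 V) (𝟙 W) x

lemma assoc_naturality₂ {V V' W W' : E} (v : V ⟶ V') (w : W ⟶ W') (X : D) :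
    (T.act.map (v ⊗ₘ w)).app X ≫ T.assoc V' W' X =
      T.assoc V W X ≫ (T.act.obj V).map ((T.act.map w).app X) ≫ (T.act.map v).app _ := by
  simpa [bifunctorMap] using T.assoc_naturality v w (𝟙 X)

section Enrichment

variable {T} {H : Dᵒᵖ ⥤ D ⥤ E} (h : T.act.flip ⊣₂ H)

/-- The evaluation `{X, Y} ⊠ X ⟶ Y`. -/
def eval (X Y : D) : (T.act.obj ((H.obj (op X)).obj Y)).obj X ⟶ Y :=
  h.homEquiv.symm (𝟙 _)

/-- Transposition becomes composition with the evaluation, so the enrichment axioms can be checked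
after evaluating. -/
lemma homEquiv_symm_eq {V : E} {X Y : D} (g : V ⟶ (H.obj (op X)).obj Y) :
    h.homEquiv.symm g = (T.act.map g).app X ≫ eval h X Y := by
  simpa [eval] using h.homEquiv_symm_naturality_two g (𝟙 _)

/-- The composition of the enrichment determined by a tensorisation. -/
def enrichedComp (X Y Z : D) :
    (H.obj (op Y)).obj Z ⊗ (H.obj (op X)).obj Y ⟶ (H.obj (op X)).obj Z :=
  h.homEquiv (X₁ := X) (T.assoc _ _ X ≫ (T.act.obj _).map (eval h X Y) ≫ eval h Y Z)

lemma enrichedComp_eval (X Y Z : D) :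
    (T.act.map (enrichedComp h X Y Z)).app X ≫ eval h X Z =
      T.assoc _ _ X ≫ (T.act.obj _).map (eval h X Y) ≫ eval h Y Z := by
  rw [← homEquiv_symm_eq, enrichedComp, Equiv.symm_apply_apply]

/-- The identities of the enrichment determined by a tensorisation. -/
def enrichedId (X : D) : 𝟙_ E ⟶ (H.obj (op X)).obj X :=
  h.homEquiv (X₁ := X) (T.unit X)

lemma enrichedId_eval (X : D) : (T.act.map (enrichedId h X)).app X ≫ eval h X X = T.unit X := by
  rw [← homEquiv_symm_eq, enrichedId, Equiv.symm_apply_apply]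

/-- The enrichment determined by a tensorisation whose functors `- ⊠ X` have right adjoints. -/
def enrichment : Enrichment E D where
  hom := H
  id := enrichedId h
  comp := enrichedComp h
  comp_assoc X Y Z W := by
    -- After evaluation, associativity is the pentagon; the two unit laws below are the two unit
    -- conditions in the same way.
    apply h.homEquiv.symm.injective
    simp only [homEquiv_symm_eq, Functor.map_comp, NatTrans.comp_app, Category.assoc,
      enrichedComp_eval, reassoc_of% T.assoc_naturality_left,
      reassoc_of% T.assoc_naturality_middle]
    simp only [← NatTrans.naturality_assoc, enrichedComp_eval,
      reassoc_of% T.assoc_naturality_right, reassoc_of% T.pentagon, ← Functor.map_comp_assoc]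
  id_comp X Y := by
    apply h.homEquiv.symm.injective
    simp only [homEquiv_symm_eq, Functor.map_comp, NatTrans.comp_app, Category.assoc,
      enrichedComp_eval, reassoc_of% T.assoc_naturality_middle]
    rw [← Functor.map_comp_assoc, enrichedId_eval, reassoc_of% T.right_unitality]
  comp_id X Y := by
    apply h.homEquiv.symm.injective
    simp only [homEquiv_symm_eq, Functor.map_comp, NatTrans.comp_app, Category.assoc,
      enrichedComp_eval, reassoc_of% T.assoc_naturality_left]
    rw [← NatTrans.naturality_assoc, enrichedId_eval, T.unit_naturality,
      reassoc_of% T.left_unitality]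

end Enrichment

end Tensorisation

/-! ### The cotensorisation determined by a tensorisation -/

namespace Tensorisation

variable {T : Tensorisation E D} {G : D ⥤ Eᵒᵖ ⥤ D} (c : T.act ⊣₂ G.flip)

/-- The map `X ⟶ ⟨X, 𝟙⟩` adjoint to `𝟙 ⊠ X ⟶ X`. -/
def cotensorUnit (X : D) : X ⟶ (G.obj X).obj (op (𝟙_ E)) :=
  cotensorEquiv c _ _ _ (T.unit X)

lemma cotensorEquiv_unit {X Y : D} (f : X ⟶ Y) :
    cotensorEquiv c _ _ _ (T.unit X ≫ f) = f ≫ cotensorUnit c Y := by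
  rw [cotensorUnit, ← cotensorEquiv_comp_left, T.unit_naturality]

/-- The map `⟨⟨Y, V⟩, W⟩ ⟶ ⟨Y, V ⊗ W⟩` mate to `(V ⊗ W) ⊠ X ⟶ V ⊠ (W ⊠ X)`. -/
def cotensorAssoc (Y : D) (V W : E) :
    (G.obj ((G.obj Y).obj (op V))).obj (op W) ⟶ (G.obj Y).obj (op (V ⊗ W)) :=
  cotensorEquiv c (V ⊗ W) _ _ (T.assoc V W _ ≫
    (cotensorEquiv c V _ _).symm ((cotensorEquiv c W _ _).symm (𝟙 _)))

/-- The definition of `cotensorAssoc` is the universal case, where `f` is the double transpose of an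
identity; naturality in `X` gives the rest. -/
lemma cotensorEquiv_assoc {V W : E} {X Y : D}
    (f : (T.act.obj V).obj ((T.act.obj W).obj X) ⟶ Y) :
    cotensorEquiv c (V ⊗ W) X Y (T.assoc V W X ≫ f) =
      cotensorEquiv c W _ _ (cotensorEquiv c V _ _ f) ≫ cotensorAssoc c Y V W := by
  obtain ⟨g, rfl⟩ := (cotensorEquiv c V _ _).symm.surjective f
  obtain ⟨g, rfl⟩ := (cotensorEquiv c W _ _).symm.surjective g
  simp only [Equiv.apply_symm_apply]
  rw [cotensorAssoc, ← cotensorEquiv_comp_left, reassoc_of% T.assoc_naturality_right,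
    ← cotensorEquiv_symm_comp_left, ← cotensorEquiv_symm_comp_left, Category.comp_id]

/-- The cotensorisation determined by a tensorisation whose functors `V ⊠ -` have right
adjoints. -/
def cotensorisation : Cotensorisation E D where
  cot := G
  unit := cotensorUnit c
  assoc := cotensorAssoc c
  unit_naturality x := by
    rw [← cotensorEquiv_unit, cotensorEquiv_comp_right, cotensorUnit]
  assoc_naturality {X X' V V' W W'} x v w := by
    refine cotensorEquiv_hom_ext₂ c fun Z f ↦ ?_
    simp only [bifunctorMap, Functor.map_comp, NatTrans.comp_app, ← Category.assoc,
      ← cotensorEquiv_comp_right, ← cotensorEquiv_map, ← cotensorEquiv_assoc]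
    rw [← cotensorEquiv_comp_left, ← cotensorEquiv_assoc, Category.assoc, Category.assoc,
      Category.assoc, ← reassoc_of% T.assoc_naturality₂]
  pentagon X U V W := by
    refine cotensorEquiv_hom_ext₂ c fun Z f ↦ ?_
    obtain ⟨f, rfl⟩ := (cotensorEquiv c U _ _).surjective f
    simp only [← Category.assoc, ← cotensorEquiv_comp_right, ← cotensorEquiv_assoc,
      ← cotensorEquiv_map, ← cotensorEquiv_comp_left]
    -- The cotensor pentagon contains `(α_ U V W).inv` and the tensor pentagon `(α_ U V W).hom`;
    -- they cancel.
    rw [Category.assoc _ _ (T.assoc U V _), T.pentagon, ← NatTrans.comp_app_assoc,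
      ← Functor.map_comp, Iso.inv_hom_id, T.act.map_id, NatTrans.id_app, Category.id_comp]
  left_unitality X V := by
    refine cotensorEquiv_hom_ext c fun Z f ↦ ?_
    simp only [← Category.assoc, ← cotensorEquiv_comp_right, ← cotensorEquiv_assoc,
      ← cotensorEquiv_map, ← cotensorEquiv_unit, ← T.left_unitality]
  right_unitality X V := by
    refine cotensorEquiv_hom_ext c fun Z f ↦ ?_
    simp only [← Category.assoc, ← cotensorEquiv_assoc,
      ← cotensorEquiv_map, ← cotensorEquiv_unit, ← T.right_unitality, ← cotensorEquiv_comp_left]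

end Tensorisation

/-- A tensorisation and a cotensorisation whose structure maps are mates, together with an
enrichment determined by the tensorisation, form a TCE structure. -/
def TCE.mkOfMates (T : Tensorisation E D) (G : Cotensorisation E D) (c : T.act ⊣₂ G.cot.flip)
    (c_unit : ∀ X, cotensorEquiv c _ _ _ (T.unit X) = G.unit X)
    (c_assoc : ∀ (V W : E) (X Y : D) (f : (T.act.obj V).obj ((T.act.obj W).obj X) ⟶ Y),
      cotensorEquiv c (V ⊗ W) X Y (T.assoc V W X ≫ f) =
        cotensorEquiv c W _ _ (cotensorEquiv c V _ _ f) ≫ G.assoc Y V W)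
    {H : Dᵒᵖ ⥤ D ⥤ E} (h : T.act.flip ⊣₂ H) : TCE E D where
  tens := T
  cotens := G
  enr := Tensorisation.enrichment h
  homEquiv V X Y := h.homEquiv (X₁ := X)
  cotEquiv V X Y := cotensorEquiv c V X Y
  homEquiv_naturality {V V' X X' Y Y'} v x y f := by
    -- In `h` the parameter is `X`, whereas `bifunctorMap` applies `v` first: the interchange law is
    -- needed here and again on the enriched side at the end.
    rw [bifunctorMap, ← NatTrans.naturality, Category.assoc]
    refine (h.homEquiv_naturality_one x ((T.act.map v).app X ≫ f ≫ y)).trans ?_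
    refine (congrArg (· ≫ _) (h.homEquiv_naturality_two (X₁ := X) v (f ≫ y))).trans ?_
    refine (congrArg (fun g ↦ (v ≫ g) ≫ _) (h.homEquiv_naturality_three y f)).trans ?_
    change (v ≫ h.homEquiv f ≫ (H.obj (op X)).map y) ≫ (H.map x.op).app Y' =
      v ≫ h.homEquiv f ≫ (H.map x.op).app Y ≫ (H.obj (op X')).map y
    rw [Category.assoc, Category.assoc, NatTrans.naturality]
  cotEquiv_naturality v x y f := by
    simp only [bifunctorMap, Category.assoc]
    rw [cotensorEquiv_map, cotensorEquiv_comp_left, cotensorEquiv_comp_right, Category.assoc,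
      Category.assoc]
  homEquiv_unit X := rfl
  homEquiv_comp X Y Z := rfl
  cotEquiv_unit := c_unit
  cotEquiv_assoc := c_assoc

lemma Tensorisation.exists_tce (T : Tensorisation E D)
    (h₁ : ∀ V, (T.act.obj V).IsLeftAdjoint) (h₂ : ∀ X, (T.act.flip.obj X).IsLeftAdjoint) :
    ∃ S : TCE E D, S.tens = T := by
  obtain ⟨G, ⟨c⟩⟩ := exists_parametrizedAdjunction_right T.act h₁
  obtain ⟨H, ⟨h⟩⟩ := exists_parametrizedAdjunction_right T.act.flip h₂
  -- `G` takes the variable of `Eᵒᵖ` first, so the cotensor bifunctor is `G.flip`; flipping twice is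
  -- the identity by definition.
  let c' : T.act ⊣₂ G.flip.flip := c
  exact ⟨.mkOfMates T (cotensorisation c') c' (fun _ ↦ rfl)
    (fun _ _ _ _ f ↦ cotensorEquiv_assoc c' f) h, rfl⟩

/-! ### The tensorisation determined by a cotensorisation -/

namespace Cotensorisation

variable (G : Cotensorisation E D)

lemma assoc_naturality_left {X X' : D} (x : X ⟶ X') (V W : E) :
    (G.cot.map ((G.cot.map x).app (op V))).app (op W) ≫ G.assoc X' V W =
      G.assoc X V W ≫ (G.cot.map x).app (op (V ⊗ W)) := by
  simpa [bifunctorMap] using G.assoc_naturality x (𝟙 V) (𝟙 W)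

lemma assoc_naturality₂ (X : D) {V V' W W' : E} (v : V' ⟶ V) (w : W' ⟶ W) :
    (G.cot.map ((G.cot.obj X).map v.op)).app (op W) ≫
      (G.cot.obj ((G.cot.obj X).obj (op V'))).map w.op ≫ G.assoc X V' W' =
      G.assoc X V W ≫ (G.cot.obj X).map (v ⊗ₘ w).op := by
  simpa [bifunctorMap] using G.assoc_naturality (𝟙 X) v w

variable {G} {F : E ⥤ D ⥤ D} (c : F ⊣₂ G.cot.flip)

/-- The map `𝟙 ⊠ X ⟶ X` adjoint to `X ⟶ ⟨X, 𝟙⟩`. -/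
def tensorUnit (X : D) : (F.obj (𝟙_ E)).obj X ⟶ X :=
  (cotensorEquiv c _ _ _).symm (G.unit X)

lemma cotensorEquiv_tensorUnit {X Y : D} (f : X ⟶ Y) :
    cotensorEquiv c _ _ _ (tensorUnit c X ≫ f) = f ≫ G.unit Y := by
  rw [tensorUnit, cotensorEquiv_comp_right, Equiv.apply_symm_apply, G.unit_naturality]

/-- The map `(V ⊗ W) ⊠ X ⟶ V ⊠ (W ⊠ X)` mate to `⟨⟨Y, V⟩, W⟩ ⟶ ⟨Y, V ⊗ W⟩`. -/
def tensorAssoc (V W : E) (X : D) :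
    (F.obj (V ⊗ W)).obj X ⟶ (F.obj V).obj ((F.obj W).obj X) :=
  (cotensorEquiv c _ _ _).symm
    (cotensorEquiv c W _ _ (cotensorEquiv c V _ _ (𝟙 _)) ≫ G.assoc _ V W)

/-- Here the universal case is `f = 𝟙`, and naturality in `Y` gives the rest. -/
lemma cotensorEquiv_tensorAssoc {V W : E} {X Y : D} (f : (F.obj V).obj ((F.obj W).obj X) ⟶ Y) :
    cotensorEquiv c (V ⊗ W) X Y (tensorAssoc c V W X ≫ f) =
      cotensorEquiv c W _ _ (cotensorEquiv c V _ _ f) ≫ G.assoc Y V W := by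
  rw [tensorAssoc, cotensorEquiv_comp_right, Equiv.apply_symm_apply, Category.assoc,
    ← G.assoc_naturality_left, ← Category.assoc, ← cotensorEquiv_comp_right,
    ← cotensorEquiv_comp_right, Category.id_comp]

/-- The tensorisation determined by a cotensorisation whose functors `⟨-, V⟩` have left
adjoints. -/
def tensorisation : Tensorisation E D where
  act := F
  unit := tensorUnit c
  assoc := tensorAssoc c
  unit_naturality x := by
    apply (cotensorEquiv c _ _ _).injective
    rw [cotensorEquiv_tensorUnit, cotensorEquiv_comp_left, tensorUnit, Equiv.apply_symm_apply]
  assoc_naturality {V V' W W' X X'} v w x := by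
    refine eq_of_cotensorEquiv_comp c fun Y f ↦ ?_
    simp only [bifunctorMap, Category.assoc, Functor.map_comp, cotensorEquiv_tensorAssoc,
      cotensorEquiv_map, cotensorEquiv_comp_left,
      cotensorEquiv_comp_right c _ ((G.cot.obj _).map _), ← G.assoc_naturality₂]
  pentagon U V W X := by
    refine eq_of_cotensorEquiv_comp c fun Y f ↦ ?_
    simp only [cotensorEquiv_tensorAssoc, cotensorEquiv_map, cotensorEquiv_comp_left,
      cotensorEquiv_comp_right c _ (G.assoc _ _ _), Category.assoc, ← reassoc_of% G.pentagon]
    rw [← Functor.map_comp, ← op_comp, Iso.hom_inv_id, op_id, G.cot.obj _ |>.map_id,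
      Category.comp_id]
  left_unitality V X := by
    refine eq_of_cotensorEquiv_comp c fun Y f ↦ ?_
    rw [Category.assoc, cotensorEquiv_tensorAssoc, cotensorEquiv_tensorUnit, cotensorEquiv_map,
      cotensorEquiv_comp_right, Category.assoc, G.left_unitality]
  right_unitality V X := by
    refine eq_of_cotensorEquiv_comp c fun Y f ↦ ?_
    rw [Category.assoc, cotensorEquiv_tensorAssoc, cotensorEquiv_comp_left,
      cotensorEquiv_tensorUnit, cotensorEquiv_map, Category.assoc, G.right_unitality]

lemma exists_tce (h₁ : ∀ V, (G.cot.flip.obj V).IsRightAdjoint)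
    (h₂ : ∀ Y, (G.cot.obj Y).IsRightAdjoint) : ∃ S : TCE E D, S.cotens = G := by
  obtain ⟨F, ⟨c⟩⟩ := exists_parametrizedAdjunction_left G.cot.flip h₁
  have h₃ (X : D) : (F.flip.obj X).IsLeftAdjoint := by
    -- With `L` left adjoint to `⟨Y, -⟩ : Eᵒᵖ ⥤ D`, `Hom(V ⊠ X, Y) ≃ Hom(X, ⟨Y, V⟩) ≃ Hom(V, L X)`,
    -- the last one in `E`; so `L X` serves as `{X, Y}`.
    let e (V : E) (Y : D) : (((F.flip.obj X).obj V) ⟶ Y) ≃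
        (V ⟶ ((G.cot.obj Y).leftAdjoint.obj X).unop) :=
      (cotensorEquiv c V X Y).trans
        (((Adjunction.ofIsRightAdjoint (G.cot.obj Y)).homEquiv X (op V)).symm.trans
          (opEquiv _ _))
    refine (Adjunction.adjunctionOfEquivRight e fun V' V Y v g ↦ ?_).isLeftAdjoint
    simp [e, cotensorEquiv_map, Adjunction.homEquiv_naturality_right_symm, opEquiv]
  obtain ⟨H, ⟨h⟩⟩ := exists_parametrizedAdjunction_right F.flip h₃
  exact ⟨.mkOfMates (tensorisation c) G c (fun _ ↦ Equiv.apply_symm_apply _ _)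
    (fun _ _ _ _ f ↦ cotensorEquiv_tensorAssoc c f) h, rfl⟩

end Cotensorisation

end TCE

/-! ### Coreflexive equalisers of coalgebras and reflexive coequalisers of algebras -/

section Limits

variable {C : Type u₁} [Category.{v₁} C]

lemma CategoryTheory.IsCoreflexivePair.map {D : Type u₂} [Category.{v₂} D] (F : C ⥤ D)
    {X Y : C} (f g : X ⟶ Y) [IsCoreflexivePair f g] : IsCoreflexivePair (F.map f) (F.map g) :=
  .mk' (F.map (commonRetraction f g)) (by simp [← F.map_comp]) (by simp [← F.map_comp])

lemma CategoryTheory.IsReflexivePair.map {D : Type u₂} [Category.{v₂} D] (F : C ⥤ D)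
    {X Y : C} (f g : X ⟶ Y) [IsReflexivePair f g] : IsReflexivePair (F.map f) (F.map g) :=
  .mk' (F.map (commonSection f g)) (by simp [← F.map_comp]) (by simp [← F.map_comp])

lemma CategoryTheory.Comonad.hasCoreflexiveEqualizers_coalgebra [HasCoreflexiveEqualizers C]
    (Q : Comonad C) [Comonad.PreservesLimitOfIsCoreflexivePair Q.toFunctor] :
    HasCoreflexiveEqualizers Q.Coalgebra where
  has_eq X Y f g _ := by
    have := IsCoreflexivePair.map Q.forget f g
    -- Creation requires `Q` to preserve the equaliser of the underlying pair and also that of its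
    -- image under `Q`; both pairs are coreflexive.
    have := IsCoreflexivePair.map Q.toFunctor (Q.forget.map f) (Q.forget.map g)
    have : HasLimit (parallelPair f g ⋙ Q.forget) :=
      hasLimit_of_iso (F := parallelPair (Q.forget.map f) (Q.forget.map g)) (diagramIsoParallelPair (parallelPair f g ⋙ Q.forget)).symm
    have : PreservesLimit (parallelPair f g ⋙ Q.forget) Q.toFunctor :=
      preservesLimit_of_iso_diagram (K₁ := parallelPair (Q.forget.map f) (Q.forget.map g)) _
        (diagramIsoParallelPair (parallelPair f g ⋙ Q.forget)).symm
    have : PreservesLimit ((parallelPair f g ⋙ Q.forget) ⋙ Q.toFunctor) Q.toFunctor :=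
      preservesLimit_of_iso_diagram
        (K₁ := parallelPair (Q.map (Q.forget.map f)) (Q.map (Q.forget.map g))) _
        (diagramIsoParallelPair ((parallelPair f g ⋙ Q.forget) ⋙ Q.toFunctor)).symm
    exact hasLimit_of_created _ Q.forget

lemma CategoryTheory.Monad.hasReflexiveCoequalizers_algebra [HasReflexiveCoequalizers C]
    (M : Monad C) [Monad.PreservesColimitOfIsReflexivePair M.toFunctor] :
    HasReflexiveCoequalizers M.Algebra where
  has_coeq X Y f g _ := by
    have := IsReflexivePair.map M.forget f g
    have := IsReflexivePair.map M.toFunctor (M.forget.map f) (M.forget.map g)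
    have : HasColimit (parallelPair f g ⋙ M.forget) :=
      hasColimit_of_iso (F := parallelPair (M.forget.map f) (M.forget.map g))
        (diagramIsoParallelPair (parallelPair f g ⋙ M.forget))
    have : PreservesColimit (parallelPair f g ⋙ M.forget) M.toFunctor :=
      preservesColimit_of_iso_diagram (K₁ := parallelPair (M.forget.map f) (M.forget.map g)) _
        (diagramIsoParallelPair (parallelPair f g ⋙ M.forget)).symm
    have : PreservesColimit ((parallelPair f g ⋙ M.forget) ⋙ M.toFunctor) M.toFunctor :=
      preservesColimit_of_iso_diagram
        (K₁ := parallelPair (M.map (M.forget.map f)) (M.map (M.forget.map g))) _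
        (diagramIsoParallelPair ((parallelPair f g ⋙ M.forget) ⋙ M.toFunctor)).symm
    exact hasColimit_of_created _ M.forget

lemma CategoryTheory.Limits.hasReflexiveCoequalizers_op [HasCoreflexiveEqualizers C] :
    HasReflexiveCoequalizers Cᵒᵖ where
  has_coeq X Y f g _ := by
    have : IsCoreflexivePair f.unop g.unop :=
      .mk' (commonSection f g).unop (by simp [← unop_comp]) (by simp [← unop_comp])
    have : HasLimit (parallelPair f.unop g.unop) := inferInstance
    exact ⟨⟨_, (Fork.isLimitEquivIsColimitOp _) (limit.isLimit (parallelPair f.unop g.unop))⟩⟩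

end Limits

/-! ### Partial adjoints in a TCE structure -/

section Pointwise

variable {C : Type u₁} [Category.{v₁} C] [MonoidalCategory C] {D : Type u₂} [Category.{v₂} D]
  (T : TCE C D)

lemma TCE.isLeftAdjoint_act (V : C) : (T.tens.act.obj V).IsLeftAdjoint :=
  (Adjunction.adjunctionOfEquivRight (fun X Y ↦ T.cotEquiv V X Y) fun X' X Y x f ↦ by
    simpa [bifunctorMap] using T.cotEquiv_naturality (𝟙 V) x (𝟙 Y) f).isLeftAdjoint

lemma TCE.isLeftAdjoint_act_flip (X : D) : (T.tens.act.flip.obj X).IsLeftAdjoint :=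
  (Adjunction.adjunctionOfEquivRight (F := T.tens.act.flip.obj X)
    (fun V Y ↦ T.homEquiv V X Y) fun V' V Y v f ↦ by
    simpa [bifunctorMap] using T.homEquiv_naturality v (𝟙 X) (𝟙 Y) f).isLeftAdjoint

lemma TCE.isRightAdjoint_cot_flip (V : Cᵒᵖ) : (T.cotens.cot.flip.obj V).IsRightAdjoint :=
  (Adjunction.adjunctionOfEquivLeft (G := T.cotens.cot.flip.obj V)
    (fun X Y ↦ T.cotEquiv V.unop X Y) fun X Y Y' y f ↦ by
    simpa [bifunctorMap] using T.cotEquiv_naturality (𝟙 V.unop) (𝟙 X) y f).isRightAdjoint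

lemma TCE.isRightAdjoint_cot (Y : D) : (T.cotens.cot.obj Y).IsRightAdjoint :=
  (Adjunction.adjunctionOfEquivLeft (G := T.cotens.cot.obj Y)
    (F_obj := fun X ↦ op ((T.enr.hom.obj (op X)).obj Y))
    (fun X V ↦ (opEquiv _ _).trans
      ((T.homEquiv V.unop X Y).symm.trans (T.cotEquiv V.unop X Y))) fun X V V' v g ↦ by
    -- Both naturality laws concern maps out of `V ⊠ X`, so `g` is first written as a transpose.
    obtain ⟨f, hf⟩ := (T.homEquiv V.unop X Y).surjective g.unop
    obtain rfl : (T.homEquiv V.unop X Y f).op = g := by simp [hf]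
    have h₁ := T.homEquiv_naturality v.unop (𝟙 X) (𝟙 Y) f
    have h₂ := T.cotEquiv_naturality v.unop (𝟙 X) (𝟙 Y) f
    simp only [bifunctorMap, CategoryTheory.Functor.map_id, Category.comp_id, NatTrans.id_app, op_id,
      Category.id_comp, Quiver.Hom.op_unop] at h₁ h₂
    simp [opEquiv, ← h₁, h₂]).isRightAdjoint

end Pointwise

/-! ### Adjoint lifting along the forgetful functors -/

theorem mainTheorem8 {C : Type u₁} [Category.{v₁} C] [MonoidalCategory C]
    {D : Type u₂} [Category.{v₂} D] (T : TCE C D)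
    [HasCoreflexiveEqualizers C]
    (Q : Comonad C) [HopfComonad Q] [Comonad.PreservesLimitOfIsCoreflexivePair Q.toFunctor] :
    (∀ [HasCoreflexiveEqualizers D]
      (R : Comonad D) [Comonad.PreservesLimitOfIsCoreflexivePair R.toFunctor]
      (B : Tensorisation Q.Coalgebra R.Coalgebra), B.Lifts T.tens →
        ∃ S : TCE Q.Coalgebra R.Coalgebra, S.tens = B) ∧
    (∀ [HasReflexiveCoequalizers D]
      (M : Monad D) [Monad.PreservesColimitOfIsReflexivePair M.toFunctor]
      (B : Cotensorisation Q.Coalgebra M.Algebra), B.Lifts T.cotens →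
        ∃ S : TCE Q.Coalgebra M.Algebra, S.cotens = B) := by
  have := Q.hasCoreflexiveEqualizers_coalgebra
  refine ⟨fun R _ B hB ↦ ?_, fun M _ B hB ↦ ?_⟩
  · have := R.hasCoreflexiveEqualizers_coalgebra
    refine B.exists_tce (fun V ↦ ?_) (fun X ↦ ?_)
    -- `V ⊠ -` covers `V.A ⊠ -` and has source `Cog(R)`; `- ⊠ X`, treated next, covers `- ⊠ X.A` and
    -- has source `Cog(Q)`.
    · have := T.isLeftAdjoint_act V.A
      exact isLeftAdjoint_square_lift_comonadic (B.act.obj V) R.forget R.forget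
        (T.tens.act.obj V.A) ((eqToIso hB.act_eq).symm.app V)
    · have := T.isLeftAdjoint_act_flip X.A
      exact isLeftAdjoint_square_lift_comonadic (B.act.flip.obj X) R.forget Q.forget
        (T.tens.act.flip.obj X.A)
        (((flipFunctor _ _ _).mapIso (eqToIso hB.act_eq)).symm.app X)
  · have := M.hasReflexiveCoequalizers_algebra
    -- `⟨X, -⟩` has source `Cog(Q)ᵒᵖ`, on which `Q.forget.op` is monadic.
    have := hasReflexiveCoequalizers_op (C := Q.Coalgebra)
    refine B.exists_tce (fun V ↦ ?_) (fun X ↦ ?_)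
    · have := T.isRightAdjoint_cot_flip (op V.unop.A)
      exact isRightAdjoint_square_lift_monadic (B.cot.flip.obj V) M.forget M.forget
        (T.cotens.cot.flip.obj (op V.unop.A))
        (((flipFunctor _ _ _).mapIso (eqToIso hB.cot_eq)).symm.app V)
    · have := T.isRightAdjoint_cot X.A
      exact isRightAdjoint_square_lift_monadic (B.cot.obj X) M.forget Q.forget.op
        (T.cotens.cot.obj X.A) ((eqToIso hB.cot_eq).symm.app X)
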